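/- **Theorem.** Let $\mathrm{Cu}_2$ be the monoid with identity $e$ and zero element $\lozenge$ generated by $s_1,s_2,s_1^*,s_2^*$ subject to the relations $s_1^*s_1=e=s_2^*s_2$ and $s_1^*s_2=\lozenge=s_2^*s_1$, with the involution that reverses products and interchanges $s_i$ and $s_i^*$. Let $\mathcal A=\ell^1(\mathrm{Cu}_2\setminus\{\lozenge\})$ (complex scalars) be the unital Banach $*$-algebra whose product $\#$ is the bounded bilinear map determined by $\delta_s\#\delta_t=\delta_{st}$ if $st\neq\lozenge$ and $\delta_s\#\delta_t=0$ if $st=\lozenge$, and whose involution is $f^*(s)=\overline{f(s^*)}$. Let $\mathcal J$ be the closed two-sided ideal of $\mathcal A$ generated by $f_0=\delta_e-\delta_{s_1s_1^*}-\delta_{s_2s_2^*}$; then $\mathcal A/\mathcal J$ is a Banach $*$-algebra with the quotient norm. For an ultrafilter $\mathcal U$ on a set $I$ and a Banach algebra $\mathcal B$, the ultrapower is $(\mathcal B)_{\mathcal U}=\ell^\infty(I,\mathcal B)/c_{\mathcal U}(\mathcal B)$, where $\ell^\infty(I,\mathcal B)$ is the Banach algebra of bounded families in $\mathcal B$ with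 pointwise operations and the supremum norm, and $c_{\mathcal U}(\mathcal B)=\{(a_i): \lim_{i\to\mathcal U}\|a_i\|=0\}$. A complex unital algebra $\mathcal C$ is called *simple* if it is non-zero and has no two-sided ideals other than $\{0\}$ and $\mathcal C$, and *purely infinite* if it is non-zero, not a division algebra, and for every non-zero $a\in\mathcal C$ there are $b,c\in\mathcal C$ with $1=bac$. Then for every countably incomplete ultrafilter $\mathcal U$ (that is, one not closed under countable intersections; on $\mathbb N$ these are exactly the non-principal ultrafilters), the non-zero Banach $*$-algebra $(\mathcal A/\mathcal J)_{\mathcal U}$ is not simple, and hence not purely infinite. -/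

import Mathlib

open Filter Topology
open scoped ENNReal ComplexConjugate

noncomputable section

namespace CuntzUltra

/-! ### The Banach algebra `ℓ¹(S ∖ {0})` of a monoid with zero -/

/-- The Banach space `ℓ¹(S ∖ {0})` of a monoid with zero element `S`. -/
def EllOne (S : Type*) [MonoidWithZero S] : Type _ :=
  lp (fun _ : {s : S // s ≠ 0} => ℂ) 1

namespace EllOne

section Monoid

variable {S : Type*} [MonoidWithZero S]

instance : NormedAddCommGroup (EllOne S) :=
  inferInstanceAs (NormedAddCommGroup (lp (fun _ : {s : S // s ≠ 0} => ℂ) 1))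

instance : NormedSpace ℂ (EllOne S) :=
  inferInstanceAs (NormedSpace ℂ (lp (fun _ : {s : S // s ≠ 0} => ℂ) 1))

instance : CompleteSpace (EllOne S) :=
  inferInstanceAs (CompleteSpace (lp (fun _ : {s : S // s ≠ 0} => ℂ) 1))

/-- The value `f(s)` of `f ∈ ℓ¹(S ∖ {0})` at `s ≠ 0`. -/
def coeff (f : EllOne S) (s : {s : S // s ≠ 0}) : ℂ :=
  (show lp (fun _ : {s : S // s ≠ 0} => ℂ) 1 from f) s

open Classical in
/-- The point mass `δ_s`, with the convention `δ_0 = 0`. -/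
def delta (s : S) : EllOne S :=
  (if h : s ≠ 0 then lp.single 1 (⟨s, h⟩ : {s : S // s ≠ 0}) (1 : ℂ) else 0 :
    lp (fun _ : {s : S // s ≠ 0} => ℂ) 1)

open Classical in
theorem delta_of_ne {s : S} (h : s ≠ 0) : (delta s : EllOne S) =
    (lp.single 1 (⟨s, h⟩ : {s : S // s ≠ 0}) (1 : ℂ) : lp (fun _ : {s : S // s ≠ 0} => ℂ) 1) :=
  dif_pos h

theorem delta_zero : (delta 0 : EllOne S) = 0 := dif_neg (by simp)

theorem coeff_ext {f g : EllOne S} (h : ∀ s, f.coeff s = g.coeff s) : f = g :=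
  lp.ext (funext h)

theorem summable_norm_coeff (f : EllOne S) : Summable fun s => ‖f.coeff s‖ := by
  have := (lp.memℓp (show lp (fun _ : {s : S // s ≠ 0} => ℂ) 1 from f)).summable
    (by norm_num)
  simp only [ENNReal.toReal_one, Real.rpow_one] at this
  exact this

theorem norm_eq_tsum (f : EllOne S) : ‖f‖ = ∑' s, ‖f.coeff s‖ := by
  have := lp.norm_eq_tsum_rpow (p := 1) (by norm_num)
    (show lp (fun _ : {s : S // s ≠ 0} => ℂ) 1 from f)
  simp only [ENNReal.toReal_one, Real.rpow_one, div_one] at this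
  exact this

@[simp] theorem coeff_add (f g : EllOne S) (s) : (f + g).coeff s = f.coeff s + g.coeff s := rfl

@[simp] theorem coeff_smul (c : ℂ) (f : EllOne S) (s) : (c • f).coeff s = c * f.coeff s := rfl

theorem norm_delta_le (s : S) : ‖delta s‖ ≤ 1 := by
  classical
  by_cases h : s ≠ 0
  · rw [delta_of_ne h]
    refine le_of_eq ?_
    refine (lp.norm_single (p := 1) (E := fun _ : {s : S // s ≠ 0} => ℂ) (by norm_num)
      ⟨s, h⟩ (1 : ℂ)).trans norm_one
  · rw [not_not.1 h, delta_zero, norm_zero]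
    exact zero_le_one

/-- The bounded linear map on `ℓ¹(S ∖ {0})` with prescribed values, of norm at most one, on the
point masses. -/
def extend {F : Type*} [NormedAddCommGroup F] [NormedSpace ℂ F] [CompleteSpace F]
    (b : {s : S // s ≠ 0} → F) (hb : ∀ s, ‖b s‖ ≤ 1) : EllOne S →L[ℂ] F :=
  have key : ∀ (f : EllOne S) s, ‖f.coeff s • b s‖ ≤ ‖f.coeff s‖ := fun f s => by
    rw [norm_smul]
    exact mul_le_of_le_one_right (norm_nonneg _) (hb s)
  have hs : ∀ f : EllOne S, Summable fun s => f.coeff s • b s := fun f =>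
    Summable.of_norm_bounded f.summable_norm_coeff (key f)
  LinearMap.mkContinuous
    { toFun := fun f => ∑' s, f.coeff s • b s
      map_add' := fun f g => by
        rw [← (hs f).tsum_add (hs g)]
        simp [add_smul]
      map_smul' := fun c f => by
        simp only [coeff_smul, mul_smul, RingHom.id_apply]
        exact (hs f).tsum_const_smul c }
    1 (fun f => by
      rw [one_mul, norm_eq_tsum]
      exact tsum_of_norm_bounded (f := fun s => f.coeff s • b s) f.summable_norm_coeff.hasSum
        (key f))

theorem extend_apply {F : Type*} [NormedAddCommGroup F] [NormedSpace ℂ F] [CompleteSpace F]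
    (b : {s : S // s ≠ 0} → F) (hb : ∀ s, ‖b s‖ ≤ 1) (f : EllOne S) :
    extend b hb f = ∑' s, f.coeff s • b s := rfl

theorem norm_extend_le {F : Type*} [NormedAddCommGroup F] [NormedSpace ℂ F] [CompleteSpace F]
    (b : {s : S // s ≠ 0} → F) (hb : ∀ s, ‖b s‖ ≤ 1) : ‖extend b hb‖ ≤ 1 :=
  ContinuousLinearMap.opNorm_le_bound _ zero_le_one fun f => by
    rw [one_mul, norm_eq_tsum, extend_apply]
    refine tsum_of_norm_bounded (f := fun s => f.coeff s • b s) f.summable_norm_coeff.hasSum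
      fun s => ?_
    rw [norm_smul]
    exact mul_le_of_le_one_right (norm_nonneg _) (hb s)

theorem coeff_delta (s t : {s : S // s ≠ 0}) [Decidable (t = s)] :
    (delta s.1).coeff t = if t = s then 1 else 0 := by
  classical
  rw [delta_of_ne s.2]
  split_ifs with h
  · subst h
    exact lp.single_apply_self (E := fun _ : {s : S // s ≠ 0} => ℂ) 1 t (1 : ℂ)
  · exact lp.single_apply_ne (E := fun _ : {s : S // s ≠ 0} => ℂ) 1 s (1 : ℂ) h

theorem extend_delta {F : Type*} [NormedAddCommGroup F] [NormedSpace ℂ F] [CompleteSpace F]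
    (b : {s : S // s ≠ 0} → F) (hb : ∀ s, ‖b s‖ ≤ 1) (s : {s : S // s ≠ 0}) :
    extend b hb (delta s.1) = b s := by
  classical
  rw [extend_apply, tsum_eq_single s]
  · simp [coeff_delta]
  · intro t ht
    simp [coeff_delta, ht]

theorem hasSum_delta (f : EllOne S) : HasSum (fun s => f.coeff s • delta s.1) f := by
  classical
  have h := lp.hasSum_single (p := 1) (by norm_num)
    (show lp (fun _ : {s : S // s ≠ 0} => ℂ) 1 from f)
  have e : (fun s : {s : S // s ≠ 0} => f.coeff s • (delta s.1 : EllOne S)) =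
      fun s => lp.single 1 s (f.coeff s) := by
    funext s
    refine coeff_ext fun t => ?_
    rw [coeff_smul, coeff_delta]
    unfold coeff
    by_cases h : t = s
    · subst h
      rw [if_pos rfl, mul_one]
      exact (lp.single_apply_self (E := fun _ : {s : S // s ≠ 0} => ℂ) 1 t _).symm
    · rw [if_neg h, mul_zero]
      exact (lp.single_apply_ne (E := fun _ : {s : S // s ≠ 0} => ℂ) 1 s _ h).symm
  rw [e]
  exact h

theorem clm_ext {F : Type*} [NormedAddCommGroup F] [NormedSpace ℂ F] {φ ψ : EllOne S →L[ℂ] F}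
    (h : ∀ s : {s : S // s ≠ 0}, φ (delta s.1) = ψ (delta s.1)) : φ = ψ := by
  ext f
  have h1 := (hasSum_delta f).mapL φ
  have h2 := (hasSum_delta f).mapL ψ
  simp only [map_smul, h] at h1 h2
  exact h1.unique h2

/-- The product of `ℓ¹(S ∖ {0})`: `f # g = ∑_{s,t} f(s) g(t) δ_{st}`, where `δ_0 = 0`. -/
instance : Mul (EllOne S) where
  mul f g := ∑' s : {s : S // s ≠ 0}, f.coeff s •
    ∑' t : {t : S // t ≠ 0}, g.coeff t • (delta (s.1 * t.1) : EllOne S)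

/-- The product as a bounded bilinear map. -/
def mulL : EllOne S →L[ℂ] EllOne S →L[ℂ] EllOne S :=
  extend (fun s => extend (fun t => delta (s.1 * t.1)) fun _ => norm_delta_le _)
    fun _ => norm_extend_le _ _

theorem mulL_apply (f g : EllOne S) : mulL f g = f * g := by
  have h1 : mulL f = ∑' s : {s : S // s ≠ 0}, f.coeff s •
    extend (fun t : {t : S // t ≠ 0} => delta (s.1 * t.1)) (fun _ => norm_delta_le _) := rfl
  have hs : Summable fun s : {s : S // s ≠ 0} => f.coeff s •
      extend (fun t : {t : S // t ≠ 0} => (delta (s.1 * t.1) : EllOne S))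
        (fun _ => norm_delta_le _) :=
    Summable.of_norm_bounded f.summable_norm_coeff fun s => by
      rw [norm_smul]
      exact mul_le_of_le_one_right (norm_nonneg _) (norm_extend_le _ _)
  rw [h1]
  exact ((ContinuousLinearMap.apply ℂ (EllOne S) g).map_tsum hs)

theorem norm_mulL_le : ‖(mulL : EllOne S →L[ℂ] EllOne S →L[ℂ] EllOne S)‖ ≤ 1 :=
  norm_extend_le _ _

theorem mulL_delta (s t : S) : mulL (delta s) (delta t) = (delta (s * t) : EllOne S) := by
  by_cases hs : s = 0
  · simp [hs, delta_zero]
  by_cases ht : t = 0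
  · simp [ht, delta_zero]
  have h1 : mulL (delta s) = extend (fun t : {t : S // t ≠ 0} => (delta (s * t.1) : EllOne S))
      (fun _ => norm_delta_le _) := extend_delta _ _ (⟨s, hs⟩ : {s : S // s ≠ 0})
  rw [h1]
  exact extend_delta _ _ (⟨t, ht⟩ : {t : S // t ≠ 0})

theorem delta_mul_delta (s t : S) : delta s * delta t = (delta (s * t) : EllOne S) := by
  rw [← mulL_apply, mulL_delta]

/-- The unit of `ℓ¹(S ∖ {0})` is `δ_e`. -/
instance : One (EllOne S) := ⟨delta 1⟩

theorem one_def : (1 : EllOne S) = delta 1 := rfl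

theorem mulL_assoc (f g h : EllOne S) : mulL (mulL f g) h = mulL f (mulL g h) := by
  have key : (ContinuousLinearMap.compL ℂ (EllOne S) (EllOne S) (EllOne S →L[ℂ] EllOne S)
        (mulL : EllOne S →L[ℂ] EllOne S →L[ℂ] EllOne S)).comp mulL =
      ((ContinuousLinearMap.compL ℂ (EllOne S) (EllOne S →L[ℂ] EllOne S)
        (EllOne S →L[ℂ] EllOne S)).flip (mulL : EllOne S →L[ℂ] EllOne S →L[ℂ] EllOne S)).comp
        ((ContinuousLinearMap.compL ℂ (EllOne S) (EllOne S) (EllOne S)).comp mulL) := by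
    refine clm_ext fun s => clm_ext fun t => clm_ext fun u => ?_
    simp [mulL_delta, mul_assoc]
  exact DFunLike.congr_fun (DFunLike.congr_fun (DFunLike.congr_fun key f) g) h

theorem one_mulL (f : EllOne S) : mulL 1 f = f := by
  have : mulL 1 = ContinuousLinearMap.id ℂ (EllOne S) :=
    clm_ext fun s => by simp [one_def, mulL_delta]
  rw [this]
  rfl

theorem mulL_one (f : EllOne S) : mulL f 1 = f := by
  have : (mulL.flip 1) = ContinuousLinearMap.id ℂ (EllOne S) :=
    clm_ext fun s => by simp [one_def, mulL_delta]
  exact DFunLike.congr_fun this f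

instance : Ring (EllOne S) :=
  { (inferInstance : AddCommGroup (EllOne S)) with
    mul := (· * ·)
    one := 1
    left_distrib := fun f g h => by simp only [← mulL_apply, map_add]
    right_distrib := fun f g h => by simp only [← mulL_apply, map_add, add_apply]
    zero_mul := fun f => by simp only [← mulL_apply, map_zero, zero_apply]
    mul_zero := fun f => by simp only [← mulL_apply, map_zero]
    mul_assoc := fun f g h => by simp only [← mulL_apply, mulL_assoc]
    one_mul := fun f => by rw [← mulL_apply, one_mulL]
    mul_one := fun f => by rw [← mulL_apply, mulL_one] }

instance : NormedRing (EllOne S) where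
  dist_eq := (inferInstance : NormedAddCommGroup (EllOne S)).dist_eq
  norm_mul_le f g := by
    rw [← mulL_apply]
    refine (mulL.le_opNorm₂ f g).trans ?_
    have := norm_mulL_le (S := S)
    have h := mul_nonneg (norm_nonneg f) (norm_nonneg g)
    nlinarith

instance : Algebra ℂ (EllOne S) :=
  Algebra.ofModule
    (fun c f g => by
      simp only [← mulL_apply, map_smul, smul_apply])
    (fun c f g => by simp only [← mulL_apply, map_smul])

instance : NormedAlgebra ℂ (EllOne S) where
  norm_smul_le := norm_smul_le

end Monoid

section Star

variable {S : Type*} [MonoidWithZero S] [StarMul S]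

theorem star_zero_eq : star (0 : S) = 0 := by
  have h : star (0 : S) * 0 = star (0 : S) := by
    conv_lhs => rw [← star_star (0 : S), star_star (0 : S), ← star_star (star (0 : S) * 0)]
    rw [star_mul, star_star, mul_zero]
  rw [← h, mul_zero]

theorem star_ne_zero_of {s : S} (h : s ≠ 0) : star s ≠ 0 := fun h' => h <| by
  rw [← star_star s, h', star_zero_eq]

/-- The involution `s ↦ s*` on `S ∖ {0}`. -/
def starEquiv : {s : S // s ≠ 0} ≃ {s : S // s ≠ 0} where
  toFun s := ⟨star s.1, star_ne_zero_of s.2⟩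
  invFun s := ⟨star s.1, star_ne_zero_of s.2⟩
  left_inv s := Subtype.ext (star_star s.1)
  right_inv s := Subtype.ext (star_star s.1)

/-- The involution `f*(s) = conj (f(s*))` of `ℓ¹(S ∖ {0})`. -/
instance : Star (EllOne S) where
  star f := (⟨fun s => conj (f.coeff ⟨star s.1, star_ne_zero_of s.2⟩), by
    refine memℓp_gen ?_
    have := (starEquiv (S := S)).summable_iff.mpr f.summable_norm_coeff
    simpa [starEquiv, Function.comp_def] using this⟩ :
    lp (fun _ : {s : S // s ≠ 0} => ℂ) 1)

theorem coeff_star (f : EllOne S) (s : {s : S // s ≠ 0}) :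
    (star f).coeff s = conj (f.coeff ⟨star s.1, star_ne_zero_of s.2⟩) := rfl

theorem norm_star_eq (f : EllOne S) : ‖star f‖ = ‖f‖ := by
  rw [norm_eq_tsum, norm_eq_tsum, ← (starEquiv (S := S)).tsum_eq]
  refine tsum_congr fun s => ?_
  rw [coeff_star, RCLike.norm_conj]
  congr 2
  exact Subtype.ext (star_star s.1)

instance : StarAddMonoid (EllOne S) where
  star_involutive f := coeff_ext fun s => by
    simp [coeff_star, star_star]
  star_add f g := coeff_ext fun s => by
    simp [coeff_star]

instance : NormedStarGroup (EllOne S) where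
  norm_star_le f := (norm_star_eq f).le

instance : StarModule ℂ (EllOne S) where
  star_smul c f := coeff_ext fun s => by
    simp [coeff_star]

theorem star_delta (s : S) : star (delta s : EllOne S) = delta (star s) := by
  classical
  by_cases hs : s = 0
  · rw [hs, star_zero_eq, delta_zero, star_zero]
  refine coeff_ext fun t => ?_
  have h1 := coeff_delta (⟨s, hs⟩ : {s : S // s ≠ 0}) ⟨star t.1, star_ne_zero_of t.2⟩
  have h2 := coeff_delta (⟨star s, star_ne_zero_of hs⟩ : {s : S // s ≠ 0}) t
  rw [coeff_star]
  dsimp only at h1 h2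
  rw [h1, h2]
  have : ((⟨star t.1, star_ne_zero_of t.2⟩ : {s : S // s ≠ 0}) = ⟨s, hs⟩) ↔
      (t = ⟨star s, star_ne_zero_of hs⟩) := by
    rw [Subtype.ext_iff, Subtype.ext_iff]
    constructor
    · intro h
      change star t.1 = s at h
      change t.1 = star s
      rw [← h, star_star]
    · intro h
      change star t.1 = s
      change t.1 = star s at h
      rw [h, star_star]
  by_cases h : t = ⟨star s, star_ne_zero_of hs⟩
  · rw [if_pos h, if_pos (this.2 h)]; simp
  · rw [if_neg h, if_neg (fun h' => h (this.1 h'))]; simp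

theorem star_mul_eq (f g : EllOne S) : star (f * g) = star g * star f := by
  have h1 : ∀ (s : S) (g : EllOne S), star (delta s * g) = star g * star (delta s) := by
    intro s g
    have hs := hasSum_delta g
    have a := ((hs.mul_left (delta s : EllOne S)).star)
    have b := (hs.star.mul_right (star (delta s : EllOne S)))
    refine a.unique ?_
    convert b using 2 with t
    rw [mul_smul_comm, star_smul, star_smul, smul_mul_assoc, delta_mul_delta, star_delta,
      star_delta, star_delta, delta_mul_delta, star_mul]
  have hs := hasSum_delta f
  have a := ((hs.mul_right g).star)
  have b := (hs.star.mul_left (star g))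
  refine a.unique ?_
  convert b using 2 with t
  rw [smul_mul_assoc, star_smul, star_smul, h1, mul_smul_comm]

instance : StarRing (EllOne S) where
  star_mul := star_mul_eq
  star_add := star_add

end Star

end EllOne

/-! ### Quotients of Banach algebras by closed two-sided ideals -/

section Quotient

variable {R : Type*} [NormedRing R] (I : Ideal R) [I.IsTwoSided] [hI : IsClosed (I : Set R)]

instance quotientNormedRing : NormedRing (R ⧸ I) where
  toNorm := (Submodule.Quotient.normedAddCommGroup I).toNorm
  toRing := Ideal.Quotient.ring I
  toMetricSpace := (Submodule.Quotient.normedAddCommGroup I).toMetricSpace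
  dist_eq := (Submodule.Quotient.normedAddCommGroup I).dist_eq
  norm_mul_le x y := by
    refine le_of_forall_pos_lt_add fun ε hε => ?_
    have hc : Tendsto (fun d : ℝ => (‖x‖ + d) * (‖y‖ + d)) (𝓝[>] 0) (𝓝 (‖x‖ * ‖y‖)) := by
      have : Continuous fun d : ℝ => (‖x‖ + d) * (‖y‖ + d) := by fun_prop
      have h := this.tendsto 0
      simp only [add_zero] at h
      exact h.mono_left nhdsWithin_le_nhds
    obtain ⟨d, hd, hd0⟩ := ((hc.eventually (gt_mem_nhds (lt_add_of_pos_right _ hε))).and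
      self_mem_nhdsWithin).exists
    obtain ⟨a, rfl, ha⟩ := Submodule.Quotient.norm_mk_lt (S := I) x hd0
    obtain ⟨b, rfl, hb⟩ := Submodule.Quotient.norm_mk_lt (S := I) y hd0
    refine lt_of_le_of_lt ?_ hd
    calc _ ≤ ‖a * b‖ := Submodule.Quotient.norm_mk_le I (a * b)
      _ ≤ ‖a‖ * ‖b‖ := norm_mul_le a b
      _ ≤ _ := mul_le_mul ha.le hb.le (norm_nonneg _) ((norm_nonneg _).trans ha.le)

instance quotientNormedAlgebra [NormedAlgebra ℂ R] : NormedAlgebra ℂ (R ⧸ I) where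
  toAlgebra := Ideal.Quotient.algebra ℂ
  norm_smul_le c x := (Submodule.Quotient.normedSpace I ℂ).norm_smul_le c x

instance quotientCompleteSpace [CompleteSpace R] : CompleteSpace (R ⧸ I) :=
  Submodule.Quotient.completeSpace I

end Quotient

section QuotientStar

/-- A `*`-ideal: an ideal that is stable under the involution. -/
class IsStarIdeal {R : Type*} [NormedRing R] [StarRing R] (I : Ideal R) : Prop where
  star_mem : ∀ a ∈ I, star a ∈ I

variable {R : Type*} [NormedRing R] (I : Ideal R) [I.IsTwoSided] [StarRing R] [IsStarIdeal I]

/-- The involution of `R ⧸ I` induced by that of `R`. -/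
instance quotientStar : Star (R ⧸ I) where
  star := Quotient.map' star fun a b h => by
    rw [Submodule.quotientRel_def] at h ⊢
    rw [← star_sub]
    exact IsStarIdeal.star_mem _ h

theorem star_mk (a : R) : star (Ideal.Quotient.mk I a) = Ideal.Quotient.mk I (star a) := rfl

instance quotientStarRing : StarRing (R ⧸ I) where
  star_involutive x := by
    obtain ⟨a, rfl⟩ := Ideal.Quotient.mk_surjective x
    rw [star_mk, star_mk, star_star]
  star_mul x y := by
    obtain ⟨a, rfl⟩ := Ideal.Quotient.mk_surjective x
    obtain ⟨b, rfl⟩ := Ideal.Quotient.mk_surjective y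
    rw [← map_mul, star_mk, star_mk, star_mk, ← map_mul, star_mul]
  star_add x y := by
    obtain ⟨a, rfl⟩ := Ideal.Quotient.mk_surjective x
    obtain ⟨b, rfl⟩ := Ideal.Quotient.mk_surjective y
    rw [← map_add, star_mk, star_mk, star_mk, ← map_add, star_add]

instance quotientNormedStarGroup [IsClosed (I : Set R)] [NormedStarGroup R] : NormedStarGroup (R ⧸ I) where
  norm_star_le x := by
    refine le_of_forall_pos_lt_add fun ε hε => ?_
    obtain ⟨a, rfl, ha⟩ := Submodule.Quotient.norm_mk_lt (S := I) x hε
    refine lt_of_le_of_lt ?_ ha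
    exact (Submodule.Quotient.norm_mk_le I (star a)).trans (norm_star a).le

instance quotientStarModule [NormedAlgebra ℂ R] [StarModule ℂ R] : StarModule ℂ (R ⧸ I) where
  star_smul c x := by
    obtain ⟨a, rfl⟩ := Ideal.Quotient.mk_surjective x
    have h : ∀ (c : ℂ) (a : R), c • Ideal.Quotient.mk I a = Ideal.Quotient.mk I (c • a) :=
      fun _ _ => rfl
    rw [h, star_mk, star_mk, h, star_smul]

end QuotientStar

/-! ### Ultrapowers -/

/-- The space `ℓ^∞(B)` of bounded families in `B` indexed by `ι`, with supremum norm. -/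
def EllInfty (ι : Type*) (B : Type*) [NormedRing B] : Type _ := lp (fun _ : ι => B) ∞

namespace EllInfty

variable {ι B : Type*} [NormedRing B]

instance : NonUnitalNormedRing (EllInfty ι B) :=
  inferInstanceAs (NonUnitalNormedRing (lp (fun _ : ι => B) ∞))

/-- The `i`-th entry of a bounded family. -/
def entry (a : EllInfty ι B) (i : ι) : B := (show lp (fun _ : ι => B) ∞ from a) i

theorem entry_ext {a b : EllInfty ι B} (h : ∀ i, a.entry i = b.entry i) : a = b :=
  lp.ext (funext h)

theorem norm_entry_le (a : EllInfty ι B) (i : ι) : ‖a.entry i‖ ≤ ‖a‖ :=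
  lp.norm_apply_le_norm (E := fun _ : ι => B) ENNReal.top_ne_zero a i

/-- The constant family `1`. -/
instance : One (EllInfty ι B) where
  one := (⟨fun _ => 1, memℓp_infty ⟨‖(1 : B)‖, by rintro _ ⟨i, rfl⟩; exact le_rfl⟩⟩ :
    lp (fun _ : ι => B) ∞)

@[simp] theorem entry_zero (i : ι) : (0 : EllInfty ι B).entry i = 0 := rfl
@[simp] theorem entry_one (i : ι) : (1 : EllInfty ι B).entry i = 1 := rfl
@[simp] theorem entry_add (a b : EllInfty ι B) (i : ι) :
    (a + b).entry i = a.entry i + b.entry i := rfl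
@[simp] theorem entry_sub (a b : EllInfty ι B) (i : ι) :
    (a - b).entry i = a.entry i - b.entry i := rfl
@[simp] theorem entry_mul (a b : EllInfty ι B) (i : ι) :
    (a * b).entry i = a.entry i * b.entry i := rfl

instance : Ring (EllInfty ι B) :=
  { (inferInstance : NonUnitalRing (EllInfty ι B)) with
    one := 1
    one_mul := fun a => entry_ext fun i => one_mul (a.entry i)
    mul_one := fun a => entry_ext fun i => mul_one (a.entry i) }

instance : NormedRing (EllInfty ι B) where
  dist_eq := NonUnitalNormedRing.dist_eq
  norm_mul_le := norm_mul_le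

instance [CompleteSpace B] : CompleteSpace (EllInfty ι B) :=
  inferInstanceAs (CompleteSpace (lp (fun _ : ι => B) ∞))

section Algebra

variable [NormedAlgebra ℂ B]

instance : NormedSpace ℂ (EllInfty ι B) :=
  inferInstanceAs (NormedSpace ℂ (lp (fun _ : ι => B) ∞))

@[simp] theorem entry_smul (c : ℂ) (a : EllInfty ι B) (i : ι) :
    (c • a).entry i = c • a.entry i := rfl

instance : Algebra ℂ (EllInfty ι B) :=
  Algebra.ofModule
    (fun c a b => entry_ext fun i => smul_mul_assoc c (a.entry i) (b.entry i))
    (fun c a b => entry_ext fun i => mul_smul_comm c (a.entry i) (b.entry i))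

instance : NormedAlgebra ℂ (EllInfty ι B) where
  norm_smul_le := norm_smul_le

end Algebra

section Star

variable [StarRing B] [NormedStarGroup B]

/-- The entrywise involution. -/
instance : StarRing (EllInfty ι B) where
  star a := (star (show lp (fun _ : ι => B) ∞ from a) : lp (fun _ : ι => B) ∞)
  star_involutive a := entry_ext fun i => star_star (a.entry i)
  star_mul a b := entry_ext fun i => star_mul (a.entry i) (b.entry i)
  star_add a b := entry_ext fun i => star_add (a.entry i) (b.entry i)

@[simp] theorem entry_star (a : EllInfty ι B) (i : ι) : (star a).entry i = star (a.entry i) := rfl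

instance : NormedStarGroup (EllInfty ι B) where
  norm_star_le a := (norm_star (show lp (fun _ : ι => B) ∞ from a)).le

instance [NormedAlgebra ℂ B] [StarModule ℂ B] : StarModule ℂ (EllInfty ι B) where
  star_smul c a := entry_ext fun i => star_smul c (a.entry i)

end Star

end EllInfty

section Ultrapower

variable {ι : Type*} (U : Ultrafilter ι) (B : Type*) [NormedRing B]

/-- The ideal `c_U(B)` of bounded families `(a_i)` with `lim_{i → U} ‖a_i‖ = 0`. -/
def nullIdeal : Ideal (EllInfty ι B) where
  carrier := {a | Tendsto (fun i => ‖a.entry i‖) U (𝓝 0)}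
  zero_mem' := by simp
  add_mem' {a b} ha hb := by
    refine squeeze_zero (fun i => norm_nonneg _) (fun i => norm_add_le (a.entry i) (b.entry i)) ?_
    simpa using Tendsto.add ha hb
  smul_mem' c a ha := by
    refine squeeze_zero (fun i => norm_nonneg _) (g := fun i => ‖c‖ * ‖a.entry i‖) (fun i => ?_) ?_
    · refine (norm_mul_le (c.entry i) (a.entry i)).trans ?_
      exact mul_le_mul_of_nonneg_right (c.norm_entry_le i) (norm_nonneg _)
    · simpa using Tendsto.const_mul ‖c‖ ha

theorem mem_nullIdeal {a : EllInfty ι B} :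
    a ∈ nullIdeal U B ↔ Tendsto (fun i => ‖a.entry i‖) U (𝓝 0) := Iff.rfl

instance : (nullIdeal U B).IsTwoSided where
  mul_mem_of_left {a} b ha := by
    rw [mem_nullIdeal] at ha ⊢
    refine squeeze_zero (fun i => norm_nonneg _) (g := fun i => ‖a.entry i‖ * ‖b‖) (fun i => ?_) ?_
    · refine (norm_mul_le (a.entry i) (b.entry i)).trans ?_
      exact mul_le_mul_of_nonneg_left (b.norm_entry_le i) (norm_nonneg _)
    · simpa using Tendsto.mul_const ‖b‖ ha

instance : IsClosed (nullIdeal U B : Set (EllInfty ι B)) := by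
  refine isClosed_of_closure_subset fun a ha => ?_
  change Tendsto (fun i => ‖a.entry i‖) U (𝓝 0)
  rw [Metric.tendsto_nhds]
  intro ε hε
  obtain ⟨b, hb, hab⟩ := Metric.mem_closure_iff.1 ha (ε / 2) (half_pos hε)
  have hb' : Tendsto (fun i => ‖b.entry i‖) U (𝓝 0) := hb
  filter_upwards [(Metric.tendsto_nhds.1 hb') (ε / 2) (half_pos hε)] with i hi
  rw [dist_zero_right, norm_norm] at hi ⊢
  have h1 : ‖a.entry i - b.entry i‖ ≤ ‖a - b‖ := (a - b).norm_entry_le i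
  rw [dist_eq_norm] at hab
  have h2 := norm_le_insert' (a.entry i) (b.entry i)
  linarith

instance [StarRing B] [NormedStarGroup B] : IsStarIdeal (nullIdeal U B) where
  star_mem a ha := by
    rw [mem_nullIdeal] at ha ⊢
    simpa using ha

/-- The ultrapower `(B)_U = ℓ^∞(B) / c_U(B)`. -/
abbrev Ultrapower : Type _ := EllInfty ι B ⧸ nullIdeal U B

end Ultrapower

/-- An ultrafilter is countably incomplete if it is not closed under countable intersections. -/
def IsCountablyIncomplete {ι : Type*} (U : Ultrafilter ι) : Prop :=
  ¬ CountableInterFilter (U : Filter ι)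

/-! ### Purely infinite algebras -/

/-- A unital algebra is purely infinite if it is not a division algebra (that is, some non-zero
element is not invertible; this also excludes the zero algebra) and the unit factors as
`1 = b a c` through every non-zero element `a`. -/
structure IsPurelyInfinite (A : Type*) [Ring A] : Prop where
  not_division : ∃ a : A, a ≠ 0 ∧ ¬ IsUnit a
  factor : ∀ a : A, a ≠ 0 → ∃ b c : A, 1 = b * a * c

/-! ### The Cuntz semigroup `Cu₂` -/

/-- The generators `s₁, s₂, s₁*, s₂*` (indexed by `Fin 2`) and the zero element `◊`. -/
inductive CuGen : Type
  | s (i : Fin 2)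
  | sStar (i : Fin 2)
  | zero

/-- The defining relations of `Cu₂` as a monoid with zero element. -/
inductive CuRel : FreeMonoid CuGen → FreeMonoid CuGen → Prop
  | star_mul_self (i : Fin 2) :
      CuRel (FreeMonoid.of (CuGen.sStar i) * FreeMonoid.of (CuGen.s i)) 1
  | star_mul_ne (i j : Fin 2) (h : i ≠ j) :
      CuRel (FreeMonoid.of (CuGen.sStar i) * FreeMonoid.of (CuGen.s j)) (FreeMonoid.of CuGen.zero)
  | zero_mul (g : CuGen) :
      CuRel (FreeMonoid.of CuGen.zero * FreeMonoid.of g) (FreeMonoid.of CuGen.zero)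
  | mul_zero (g : CuGen) :
      CuRel (FreeMonoid.of g * FreeMonoid.of CuGen.zero) (FreeMonoid.of CuGen.zero)

/-- The second Cuntz semigroup
`⟨s₁, s₂, s₁*, s₂* : s₁* s₁ = e = s₂* s₂, s₁* s₂ = ◊ = s₂* s₁⟩`. -/
def Cu2 : Type := PresentedMonoid CuRel

namespace Cu2

instance : Monoid Cu2 := inferInstanceAs (Monoid (PresentedMonoid CuRel))

/-- The class of a generator. -/
def of (g : CuGen) : Cu2 := PresentedMonoid.of CuRel g

/-- The elements `s₁ = s 0` and `s₂ = s 1`. -/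
def s (i : Fin 2) : Cu2 := of (CuGen.s i)

instance : Zero Cu2 := ⟨of CuGen.zero⟩

theorem induction {P : Cu2 → Prop} (h1 : P 1) (hmul : ∀ g x, P x → P (of g * x)) (x : Cu2) :
    P x := by
  obtain ⟨w, rfl⟩ := PresentedMonoid.surjective_mk (rels := CuRel) x
  induction w using FreeMonoid.inductionOn' with
  | one => exact h1
  | of_mul g w ih => exact hmul g _ ih

theorem zero_mul_of (g : CuGen) : (0 : Cu2) * of g = 0 :=
  PresentedMonoid.mk_eq_mk_of_rel (CuRel.zero_mul g)

theorem of_mul_zero (g : CuGen) : of g * (0 : Cu2) = 0 :=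
  PresentedMonoid.mk_eq_mk_of_rel (CuRel.mul_zero g)

instance : MonoidWithZero Cu2 where
  zero_mul x := by
    induction x using Cu2.induction with
    | h1 => exact mul_one 0
    | hmul g x ih => rw [← mul_assoc, zero_mul_of, ih]
  mul_zero x := by
    induction x using Cu2.induction with
    | h1 => exact one_mul 0
    | hmul g x ih => rw [mul_assoc, ih, of_mul_zero]

/-- The involution on generators. -/
def genStar : CuGen → CuGen
  | CuGen.s i => CuGen.sStar i
  | CuGen.sStar i => CuGen.s i
  | CuGen.zero => CuGen.zero

theorem sStar_mul_s (i : Fin 2) : of (CuGen.sStar i) * s i = 1 :=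
  PresentedMonoid.mk_eq_mk_of_rel (CuRel.star_mul_self i)

theorem sStar_mul_s_ne {i j : Fin 2} (h : i ≠ j) : of (CuGen.sStar i) * s j = 0 :=
  PresentedMonoid.mk_eq_mk_of_rel (CuRel.star_mul_ne i j h)

/-- The involution as a homomorphism to the opposite monoid. -/
def starHom : Cu2 →* Cu2ᵐᵒᵖ :=
  PresentedMonoid.lift (fun g => MulOpposite.op (of (genStar g))) (by
    rintro _ _ (i | ⟨i, j, h⟩ | g | g)
    · exact congrArg MulOpposite.op (sStar_mul_s i)
    · exact congrArg MulOpposite.op (sStar_mul_s_ne h.symm)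
    · exact congrArg MulOpposite.op (of_mul_zero (genStar g))
    · exact congrArg MulOpposite.op (zero_mul_of (genStar g)))

/-- The involution with `s_i ↦ s_i*`, reversing products. -/
instance : StarMul Cu2 where
  star x := (starHom x).unop
  star_involutive x := by
    change (starHom (starHom x).unop).unop = x
    induction x using Cu2.induction with
    | h1 => simp
    | hmul g x ih =>
      have h : ∀ g, starHom (of g) = MulOpposite.op (of (genStar g)) := fun _ => rfl
      rw [map_mul, MulOpposite.unop_mul, map_mul, MulOpposite.unop_mul, ih, h,
        MulOpposite.unop_op, h, MulOpposite.unop_op]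
      cases g <;> rfl
  star_mul x y := by
    rw [map_mul, MulOpposite.unop_mul]

theorem star_of (g : CuGen) : star (of g) = of (genStar g) := rfl

end Cu2

/-! ### The Banach `*`-algebras `𝒜` and `𝒜 / 𝒥` -/

/-- `𝒜 = (ℓ¹(Cu₂ ∖ {◊}), #)`. -/
abbrev CuntzAlg : Type := EllOne Cu2

/-- `f₀ = δ_e - δ_{s₁ s₁*} - δ_{s₂ s₂*}`. -/
def f0 : CuntzAlg :=
  EllOne.delta 1 - EllOne.delta (Cu2.s 0 * star (Cu2.s 0))
    - EllOne.delta (Cu2.s 1 * star (Cu2.s 1))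

/-- `𝒥`, the closed two-sided ideal of `𝒜` generated by `f₀`, i.e. the smallest closed two-sided
ideal that contains `f₀`. -/
def cuntzIdeal : Ideal CuntzAlg :=
  sInf {I : Ideal CuntzAlg | I.IsTwoSided ∧ IsClosed (I : Set CuntzAlg) ∧ f0 ∈ I}

theorem mem_cuntzIdeal {f : CuntzAlg} : f ∈ cuntzIdeal ↔
    ∀ I : Ideal CuntzAlg, I.IsTwoSided ∧ IsClosed (I : Set CuntzAlg) ∧ f0 ∈ I → f ∈ I := by
  simp [cuntzIdeal, Submodule.mem_sInf]

instance : cuntzIdeal.IsTwoSided where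
  mul_mem_of_left {a} b ha := mem_cuntzIdeal.2 fun I hI => by
    have := hI.1
    exact I.mul_mem_right b (mem_cuntzIdeal.1 ha I hI)

instance : IsClosed (cuntzIdeal : Set CuntzAlg) := by
  have : (cuntzIdeal : Set CuntzAlg) = ⋂ I ∈ {I : Ideal CuntzAlg | I.IsTwoSided ∧
      IsClosed (I : Set CuntzAlg) ∧ f0 ∈ I}, (I : Set CuntzAlg) := by
    simp [cuntzIdeal]
  rw [this]
  exact isClosed_biInter fun I hI => hI.2.1

theorem star_f0 : star f0 = f0 := by
  simp [f0, EllOne.star_delta]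

instance : IsStarIdeal cuntzIdeal where
  star_mem a ha := by
    let K : Ideal CuntzAlg :=
      { carrier := {x | star x ∈ cuntzIdeal}
        zero_mem' := by simp
        add_mem' := fun {x y} hx hy => by
          change star (x + y) ∈ cuntzIdeal
          rw [star_add]; exact add_mem hx hy
        smul_mem' := fun c x hx => by
          change star (c * x) ∈ cuntzIdeal
          rw [star_mul]; exact cuntzIdeal.mul_mem_right _ hx }
    refine mem_cuntzIdeal.1 ha K ⟨⟨fun {x} y hx => ?_⟩, ?_, ?_⟩
    · change star (x * y) ∈ cuntzIdeal
      rw [star_mul]; exact cuntzIdeal.mul_mem_left _ hx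
    · have hc : IsClosed (cuntzIdeal : Set CuntzAlg) := inferInstance
      exact hc.preimage continuous_star
    · change star f0 ∈ cuntzIdeal
      rw [star_f0]
      exact mem_cuntzIdeal.2 fun I hI => hI.2.2

/-- The Banach `*`-algebra `𝒜 / 𝒥`. -/
abbrev CuntzQuot : Type := CuntzAlg ⧸ cuntzIdeal

end CuntzUltra

end

/-! The quotient `𝒜 / 𝒥` has a contractive unital representation that is not bounded below, and the
ultrapower turns this defect into a kernel. Let `m` be the mean of `s₁` and `s₂`. The representation
acts on bounded functions on `ℕ`: `sᵢ` spreads a function over one residue class mod 2 and `sᵢ*` is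
composition with `k ↦ 2k + i` (`i` being 0 or 1).

The two copies produced by `s₁` and `s₂` have disjoint supports, so in the supremum norm `s₁ + s₂`
is a contraction and `m ^ n` acts with norm at most `2⁻ⁿ`. The adjoint `m*` acts as a mean of two
composition operators, which fixes the constant function 1, so its powers keep norm at least 1. The
involution of `𝒜 / 𝒥` is isometric, hence `‖m ^ n‖ = ‖(m*) ^ n‖ ≥ 1` there, although the image of `m
^ n` tends to 0. The target carries no compatible isometric involution, and this leaves room for the
asymmetry (`ContractiveCuntzFamily.exists_ne_zero_map_quotRep_eq_zero`).

Countable incompleteness supplies `N : ι → ℕ` tending to infinity along `U`. The class of `(m ^ N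
i)` is then non-zero in the ultrapower, yet the ultrapower of the representation, a unital
homomorphism into a non-zero ring, kills it. Its kernel is a proper non-zero ideal, and no element
of it can satisfy `1 = b a c`. -/

namespace CuntzUltra

open scoped BoundedContinuousFunction

/-! ### Contractive representations of `ℓ¹(S ∖ {0})` -/

namespace EllOne

variable {S D : Type*} [MonoidWithZero S] [NormedRing D] [NormedAlgebra ℂ D] [CompleteSpace D]

/-- The algebra homomorphism on `ℓ¹(S ∖ {0})` induced by a contractive representation of `S`. -/
noncomputable def lift (ρ : S →*₀ D) (hρ : ∀ s, ‖ρ s‖ ≤ 1) : EllOne S →+* D :=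
  -- The case `s = 0` matters: a product of two point masses is `delta (s * t)`, where `s * t` may
  -- vanish.
  have hδ : ∀ s : S, extend (fun s : {s : S // s ≠ 0} => ρ s.1) (fun s => hρ s.1) (delta s) =
      ρ s := fun s => by
    by_cases hs : s = 0
    · rw [hs, delta_zero, map_zero, map_zero]
    · exact extend_delta _ _ (⟨s, hs⟩ : {s : S // s ≠ 0})
  have hmul : ∀ f g : EllOne S,
      extend (fun s : {s : S // s ≠ 0} => ρ s.1) (fun s => hρ s.1) (f * g) =
        extend (fun s : {s : S // s ≠ 0} => ρ s.1) (fun s => hρ s.1) f *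
          extend (fun s : {s : S // s ≠ 0} => ρ s.1) (fun s => hρ s.1) g := fun f g => by
    set φ := extend (fun s : {s : S // s ≠ 0} => ρ s.1) (fun s => hρ s.1)
    -- Multiplicativity passes from point masses to all elements one variable at a time, by
    -- comparing sums of the same series: here in `g`, afterwards in `f`.
    have hsg : ∀ s : S, φ (delta s * g) = φ (delta s) * φ g := fun s => by
      have h1 := ((hasSum_delta g).mul_left (delta s : EllOne S)).mapL φ
      refine h1.unique ?_
      rw [funext fun t : {s : S // s ≠ 0} => (?_ : φ (delta s * g.coeff t • delta t.1) =
        φ (delta s) * φ (g.coeff t • delta t.1))]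
      · exact ((hasSum_delta g).mapL φ).mul_left (φ (delta s))
      rw [mul_smul_comm, map_smul, map_smul, mul_smul_comm, delta_mul_delta, hδ, hδ, hδ, map_mul]
    have h1 := ((hasSum_delta f).mul_right g).mapL φ
    refine h1.unique ?_
    rw [funext fun t : {s : S // s ≠ 0} => (?_ : φ (f.coeff t • delta t.1 * g) =
      φ (f.coeff t • delta t.1) * φ g)]
    · exact ((hasSum_delta f).mapL φ).mul_right (φ g)
    rw [smul_mul_assoc, map_smul, map_smul, smul_mul_assoc, hsg]
  { toFun := extend (fun s : {s : S // s ≠ 0} => ρ s.1) (fun s => hρ s.1)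
    map_zero' := map_zero _
    map_one' := by rw [one_def, hδ, map_one]
    map_add' := map_add _
    map_mul' := hmul }

theorem lift_apply (ρ : S →*₀ D) (hρ : ∀ s, ‖ρ s‖ ≤ 1) (f : EllOne S) :
    lift ρ hρ f = extend (fun s : {s : S // s ≠ 0} => ρ s.1) (fun s => hρ s.1) f := rfl

theorem lift_delta (ρ : S →*₀ D) (hρ : ∀ s, ‖ρ s‖ ≤ 1) (s : S) : lift ρ hρ (delta s) = ρ s := by
  by_cases hs : s = 0
  · rw [hs, delta_zero, map_zero, map_zero]
  · exact extend_delta _ _ (⟨s, hs⟩ : {s : S // s ≠ 0})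

theorem lift_smul (ρ : S →*₀ D) (hρ : ∀ s, ‖ρ s‖ ≤ 1) (c : ℂ) (f : EllOne S) :
    lift ρ hρ (c • f) = c • lift ρ hρ f := by
  rw [lift_apply, lift_apply, map_smul]

theorem norm_lift_le (ρ : S →*₀ D) (hρ : ∀ s, ‖ρ s‖ ≤ 1) (f : EllOne S) :
    ‖lift ρ hρ f‖ ≤ ‖f‖ :=
  ContinuousLinearMap.le_of_opNorm_le_of_le _ (norm_extend_le _ _) le_rfl |>.trans_eq (one_mul _)

theorem continuous_lift (ρ : S →*₀ D) (hρ : ∀ s, ‖ρ s‖ ≤ 1) : Continuous (lift ρ hρ) :=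
  (extend (fun s : {s : S // s ≠ 0} => ρ s.1) (fun s => hρ s.1)).continuous

end EllOne

/-- A contractive homomorphism that vanishes on an ideal is contractive on the quotient. -/
theorem norm_quotient_lift_le {R D : Type*} [NormedRing R] [NormedRing D] (I : Ideal R)
    [I.IsTwoSided] [IsClosed (I : Set R)] (φ : R →+* D) (hφ : ∀ x, ‖φ x‖ ≤ ‖x‖)
    (hI : ∀ x ∈ I, φ x = 0) (x : R ⧸ I) : ‖Ideal.Quotient.lift I φ hI x‖ ≤ ‖x‖ := by
  refine le_of_forall_pos_lt_add fun ε hε => ?_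
  obtain ⟨a, rfl, ha⟩ := Submodule.Quotient.norm_mk_lt (S := I) x hε
  exact (hφ a).trans_lt ha

/-! ### Ultrapowers of contractive homomorphisms -/

namespace EllInfty

variable {ι B D : Type*} [NormedRing B] [NormedRing D]

/-- The bounded family with the given entries. -/
noncomputable def ofBounded (x : ι → B) (C : ℝ) (hx : ∀ i, ‖x i‖ ≤ C) : EllInfty ι B :=
  (⟨x, memℓp_infty ⟨C, by rintro _ ⟨i, rfl⟩; exact hx i⟩⟩ : lp (fun _ : ι => B) ∞)

@[simp] theorem entry_ofBounded (x : ι → B) (C : ℝ) (hx : ∀ i, ‖x i‖ ≤ C) (i : ι) :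
    (ofBounded x C hx).entry i = x i := rfl

/-- The entrywise application of a contractive homomorphism. -/
noncomputable def map (φ : B →+* D) (hφ : ∀ x, ‖φ x‖ ≤ ‖x‖) : EllInfty ι B →+* EllInfty ι D where
  toFun a := ofBounded (fun i => φ (a.entry i)) ‖a‖ fun i => (hφ _).trans (norm_entry_le _ i)
  map_one' := entry_ext fun i => by simp
  map_zero' := entry_ext fun i => by simp
  map_mul' _ _ := entry_ext fun i => by simp
  map_add' _ _ := entry_ext fun i => by simp

@[simp] theorem entry_map (φ : B →+* D) (hφ : ∀ x, ‖φ x‖ ≤ ‖x‖) (a : EllInfty ι B) (i : ι) :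
    (map φ hφ a).entry i = φ (a.entry i) := rfl

end EllInfty

namespace Ultrapower

variable {ι B D : Type*} [NormedRing B] [NormedRing D] (U : Ultrafilter ι)

/-- The ultrapower of a contractive homomorphism. -/
noncomputable def map (φ : B →+* D) (hφ : ∀ x, ‖φ x‖ ≤ ‖x‖) : Ultrapower U B →+* Ultrapower U D :=
  Ideal.Quotient.lift _ ((Ideal.Quotient.mk (nullIdeal U D)).comp (EllInfty.map φ hφ))
    fun _ ha => Ideal.Quotient.eq_zero_iff_mem.2 <| (mem_nullIdeal U D).2 <|
      squeeze_zero (fun _ => norm_nonneg _) (fun _ => hφ _) ((mem_nullIdeal U B).1 ha)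

theorem map_mk (φ : B →+* D) (hφ : ∀ x, ‖φ x‖ ≤ ‖x‖) (a : EllInfty ι B) :
    map U φ hφ (Ideal.Quotient.mk _ a) = Ideal.Quotient.mk _ (EllInfty.map φ hφ a) := rfl

instance [Nontrivial B] : Nontrivial (Ultrapower U B) :=
  Ideal.Quotient.nontrivial_iff.2 <| (Ideal.ne_top_iff_one _).2 fun h => by
    have h1 : Tendsto (fun _ : ι => ‖(1 : B)‖) U (𝓝 0) := (mem_nullIdeal U B).1 h
    exact norm_ne_zero_iff.2 one_ne_zero (tendsto_nhds_unique tendsto_const_nhds h1)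

/-- If a contractive homomorphism `φ` shrinks a bounded sequence that is bounded away from zero
to zero, then its ultrapower along a sequence tending to infinity is not injective. -/
theorem exists_ne_zero_map_eq_zero (φ : B →+* D) (hφ : ∀ x, ‖φ x‖ ≤ ‖x‖) {x : ℕ → B} {c C : ℝ}
    (hc : 0 < c) (hcx : ∀ n, c ≤ ‖x n‖) (hxC : ∀ n, ‖x n‖ ≤ C)
    (hx : Tendsto (fun n => ‖φ (x n)‖) atTop (𝓝 0)) {N : ι → ℕ} (hN : Tendsto N U atTop) :
    ∃ α : Ultrapower U B, α ≠ 0 ∧ map U φ hφ α = 0 := by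
  refine ⟨Ideal.Quotient.mk _ (EllInfty.ofBounded (fun i => x (N i)) C fun i => hxC _),
    fun h => ?_, ?_⟩
  · have h0 : Tendsto (fun i => ‖x (N i)‖) U (𝓝 0) :=
      (mem_nullIdeal U B).1 (Ideal.Quotient.eq_zero_iff_mem.1 h)
    -- A limit 0 along `U` would contradict the uniform lower bound `c`.
    exact hc.not_ge (ge_of_tendsto h0 (Eventually.of_forall fun i => hcx _))
  · rw [map_mk]
    exact Ideal.Quotient.eq_zero_iff_mem.2 ((mem_nullIdeal U D).2 (hx.comp hN))

end Ultrapower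

/-! ### Countable incompleteness, and obstructions to simplicity and pure infiniteness -/

/-- Countably many members of `U` whose intersection is not in `U` give a function to `ℕ`: send a
point to the first member that misses it. -/
theorem IsCountablyIncomplete.exists_tendsto {ι : Type*} {U : Ultrafilter ι}
    (hU : IsCountablyIncomplete U) : ∃ N : ι → ℕ, Tendsto N U atTop := by
  have h : ∃ A : ℕ → Set ι, (∀ n, A n ∈ U) ∧ ⋂ n, A n ∉ U := by
    by_contra! h
    refine hU ⟨fun T hT hTU => ?_⟩
    rcases T.eq_empty_or_nonempty with rfl | hne
    · simp
    obtain ⟨A, rfl⟩ := hT.exists_eq_range hne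
    rw [Set.sInter_range]
    exact h A fun n => hTU _ ⟨n, rfl⟩
  obtain ⟨A, hA, hAU⟩ := h
  -- On `⋂ n, A n` the infimum is that of the empty set and takes the default value 0. This is
  -- harmless, since the complement of that intersection belongs to `U`.
  refine ⟨fun i => sInf {n | i ∉ A n}, tendsto_atTop.2 fun m => ?_⟩
  -- A point that lies in `A k` for all `k < m` is first missed at an index at least `m`.
  have hm : (⋂ k ∈ Set.Iio m, A k) ∈ U := (biInter_mem (Set.finite_Iio m)).2 fun k _ => hA k
  filter_upwards [hm, Ultrafilter.compl_mem_iff_notMem.2 hAU] with i hi hi'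
  have hne : {n | i ∉ A n}.Nonempty := by
    simpa [Set.Nonempty, Set.mem_iInter] using hi'
  by_contra! hlt
  exact Nat.sInf_mem hne (Set.mem_iInter₂.1 hi _ hlt)

/-- A ring hom to a non-zero ring that kills a non-zero element obstructs simplicity. -/
theorem not_isSimpleRing_of_map_eq_zero {A D : Type*} [Ring A] [Ring D] [Nontrivial D]
    (Φ : A →+* D) {α : A} (hα : α ≠ 0) (h : Φ α = 0) : ¬ IsSimpleRing A := fun _ =>
  hα (Φ.injective (h.trans (map_zero Φ).symm))

/-- A ring hom to a non-zero ring that kills a non-zero element obstructs pure infiniteness. -/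
theorem not_isPurelyInfinite_of_map_eq_zero {A D : Type*} [Ring A] [Ring D] [Nontrivial D]
    (Φ : A →+* D) {α : A} (hα : α ≠ 0) (h : Φ α = 0) : ¬ IsPurelyInfinite A := fun hA => by
  obtain ⟨b, c, hbc⟩ := hA.factor α hα
  have := congrArg Φ hbc
  simp [h] at this

/-! ### Representations of `𝒜 / 𝒥` -/

/-- Contractions `s₁, s₂, t₁, t₂` that satisfy the relations of `𝒜 / 𝒥`, with `tᵢ = sᵢ*`. -/
structure ContractiveCuntzFamily (D : Type*) [NormedRing D] where
  s : Fin 2 → D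
  t : Fin 2 → D
  norm_s_le : ∀ i, ‖s i‖ ≤ 1
  norm_t_le : ∀ i, ‖t i‖ ≤ 1
  t_mul_s : ∀ i j, t i * s j = if i = j then 1 else 0
  sum_s_mul_t : s 0 * t 0 + s 1 * t 1 = 1

namespace ContractiveCuntzFamily

variable {D : Type*} [NormedRing D] (F : ContractiveCuntzFamily D)

/-- The images of the generators of `Cu₂`. -/
def gen : CuGen → D
  | CuGen.s i => F.s i
  | CuGen.sStar i => F.t i
  | CuGen.zero => 0

theorem norm_gen_le (g : CuGen) : ‖F.gen g‖ ≤ 1 := by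
  cases g with
  | s i => exact F.norm_s_le i
  | sStar i => exact F.norm_t_le i
  | zero => simp [gen]

/-- The representation of `Cu₂` given by a Cuntz family. -/
def action : Cu2 →*₀ D :=
  let φ : Cu2 →* D := PresentedMonoid.lift F.gen (by
    rintro _ _ (i | ⟨i, j, h⟩ | g | g)
    · simpa [gen] using F.t_mul_s i i
    · simpa [gen, h] using F.t_mul_s i j
    · simp [gen]
    · simp [gen])
  -- The zero of `Cu2` is the class of the generator `CuGen.zero`, which `gen` sends to 0.
  { φ with map_zero' := rfl }

theorem action_of (g : CuGen) : F.action (Cu2.of g) = F.gen g := rfl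

theorem action_s (i : Fin 2) : F.action (Cu2.s i) = F.s i := rfl

theorem action_star_s (i : Fin 2) : F.action (star (Cu2.s i)) = F.t i := rfl

variable [NormOneClass D]

theorem norm_action_le (x : Cu2) : ‖F.action x‖ ≤ 1 := by
  induction x using Cu2.induction with
  | h1 => rw [map_one, norm_one]
  | hmul g x ih =>
    rw [map_mul, action_of]
    exact (norm_mul_le _ _).trans (mul_le_one₀ (F.norm_gen_le g) (norm_nonneg _) ih)

variable [NormedAlgebra ℂ D] [CompleteSpace D]

/-- The representation of `𝒜` given by a Cuntz family. -/
noncomputable def rep : CuntzAlg →+* D := EllOne.lift F.action F.norm_action_le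

theorem norm_rep_le (f : CuntzAlg) : ‖F.rep f‖ ≤ ‖f‖ :=
  EllOne.norm_lift_le F.action F.norm_action_le f

theorem rep_delta (x : Cu2) : F.rep (EllOne.delta x) = F.action x :=
  EllOne.lift_delta F.action F.norm_action_le x

theorem rep_smul (c : ℂ) (f : CuntzAlg) : F.rep (c • f) = c • F.rep f :=
  EllOne.lift_smul F.action F.norm_action_le c f

theorem rep_f0 : F.rep f0 = 0 := by
  rw [f0, map_sub, map_sub, rep_delta, rep_delta, rep_delta, map_one, map_mul, map_mul, action_s,
    action_s, action_star_s, action_star_s, ← F.sum_s_mul_t]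
  abel

/-- The kernel of a continuous homomorphism is a closed two-sided ideal. It contains `f0`, hence the
smallest such ideal. -/
theorem rep_eq_zero_of_mem {f : CuntzAlg} (hf : f ∈ cuntzIdeal) : F.rep f = 0 :=
  RingHom.mem_ker.1 (mem_cuntzIdeal.1 hf (RingHom.ker F.rep) ⟨inferInstance,
    isClosed_singleton.preimage (EllOne.continuous_lift F.action F.norm_action_le), F.rep_f0⟩)

/-- The representation of `𝒜 / 𝒥` given by a Cuntz family. -/
noncomputable def quotRep : CuntzQuot →+* D :=
  Ideal.Quotient.lift cuntzIdeal F.rep fun _ => F.rep_eq_zero_of_mem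

theorem quotRep_mk (f : CuntzAlg) : F.quotRep (Ideal.Quotient.mk cuntzIdeal f) = F.rep f := rfl

theorem norm_quotRep_le (x : CuntzQuot) : ‖F.quotRep x‖ ≤ ‖x‖ :=
  norm_quotient_lift_le cuntzIdeal F.rep F.norm_rep_le (fun _ => F.rep_eq_zero_of_mem) x

end ContractiveCuntzFamily

/-! ### The mean of the generators -/

/-- The mean `(δ_{s₁} + δ_{s₂}) / 2` of the two generators. -/
noncomputable def genMean : CuntzAlg :=
  (1 / 2 : ℂ) • (EllOne.delta (Cu2.s 0) + EllOne.delta (Cu2.s 1))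

theorem norm_half_smul_le {E : Type*} [SeminormedAddCommGroup E] [NormedSpace ℂ E] {x : E} {r : ℝ}
    (hx : ‖x‖ ≤ 2 * r) : ‖(1 / 2 : ℂ) • x‖ ≤ r := by
  rw [norm_smul]
  norm_num
  linarith

theorem norm_genMean_le : ‖genMean‖ ≤ 1 := by
  refine norm_half_smul_le ((norm_add_le _ _).trans ?_)
  have h0 := EllOne.norm_delta_le (Cu2.s 0)
  have h1 := EllOne.norm_delta_le (Cu2.s 1)
  linarith

theorem norm_mk_genMean_pow_le (n : ℕ) :
    ‖(Ideal.Quotient.mk cuntzIdeal (genMean ^ n) : CuntzQuot)‖ ≤ 1 := by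
  -- This covers the exponent 0.
  have h1 : ‖(1 : CuntzAlg)‖ ≤ 1 := EllOne.norm_delta_le 1
  refine (Submodule.Quotient.norm_mk_le cuntzIdeal (genMean ^ n)).trans ?_
  induction n with
  | zero => simpa using h1
  | succ n ih =>
    rw [pow_succ]
    exact (norm_mul_le _ _).trans (mul_le_one₀ ih (norm_nonneg _) norm_genMean_le)

namespace ContractiveCuntzFamily

variable {D : Type*} [NormedRing D] [NormOneClass D] [NormedAlgebra ℂ D] [CompleteSpace D]
  (F : ContractiveCuntzFamily D)

theorem rep_genMean : F.rep genMean = (1 / 2 : ℂ) • (F.s 0 + F.s 1) := by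
  rw [genMean, rep_smul, map_add, rep_delta, rep_delta, action_s, action_s]

theorem rep_star_genMean : F.rep (star genMean) = (1 / 2 : ℂ) • (F.t 0 + F.t 1) := by
  rw [genMean, star_smul, star_add, EllOne.star_delta, EllOne.star_delta, rep_smul, map_add,
    rep_delta, rep_delta, action_star_s, action_star_s]
  simp

/-- The quotient involution is isometric, so the norm of a power of `genMean` can be bounded below
through its adjoint, which the representation sends to the mean of the `F.t i`. -/
theorem norm_pow_le_norm_mk_genMean_pow (n : ℕ) :
    ‖((1 / 2 : ℂ) • (F.t 0 + F.t 1)) ^ n‖ ≤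
      ‖(Ideal.Quotient.mk cuntzIdeal (genMean ^ n) : CuntzQuot)‖ := by
  rw [← norm_star (Ideal.Quotient.mk cuntzIdeal _), star_mk, star_pow, ← rep_star_genMean, ← map_pow, ← quotRep_mk]
  exact F.norm_quotRep_le _

/-- The image of `genMean` has norm at most 1/2, so its powers decay geometrically. -/
theorem tendsto_norm_quotRep_genMean_pow (h : ‖F.s 0 + F.s 1‖ ≤ 1) :
    Tendsto (fun n => ‖F.quotRep (Ideal.Quotient.mk cuntzIdeal (genMean ^ n))‖) atTop (𝓝 0) := by
  refine squeeze_zero (fun _ => norm_nonneg _) (g := fun n : ℕ => (1 / 2 : ℝ) ^ n) (fun n => ?_)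
    (tendsto_pow_atTop_nhds_zero_of_lt_one (by norm_num) (by norm_num))
  rw [quotRep_mk, map_pow, rep_genMean]
  exact (norm_pow_le _ n).trans
    (pow_le_pow_left₀ (norm_nonneg _) (norm_half_smul_le (by linarith)) n)

/-- In a Cuntz family with `‖s₁ + s₂‖ ≤ 1` the mean of the isometries has small powers. If the
powers of the mean of the adjoints stay large, then the representation that the family induces is
not bounded below, and its ultrapower is not injective. -/
theorem exists_ne_zero_map_quotRep_eq_zero (hs : ‖F.s 0 + F.s 1‖ ≤ 1)
    (ht : ∀ n : ℕ, 1 ≤ ‖((1 / 2 : ℂ) • (F.t 0 + F.t 1)) ^ n‖) {ι : Type*} {U : Ultrafilter ι}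
    (hU : IsCountablyIncomplete U) :
    ∃ α : Ultrapower U CuntzQuot, α ≠ 0 ∧ Ultrapower.map U F.quotRep F.norm_quotRep_le α = 0 := by
  obtain ⟨N, hN⟩ := hU.exists_tendsto
  -- The powers of `genMean` in the quotient have norm exactly 1: `ht` gives the lower bound,
  -- contractivity of `genMean` the upper one.
  exact Ultrapower.exists_ne_zero_map_eq_zero U F.quotRep F.norm_quotRep_le one_pos
    (fun n => (ht n).trans (F.norm_pow_le_norm_mk_genMean_pow n)) norm_mk_genMean_pow_le
    (F.tendsto_norm_quotRep_genMean_pow hs) hN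

end ContractiveCuntzFamily

/-! ### A Cuntz family on the bounded functions on `ℕ` -/

/-- This gives the identity operator norm 1 and makes the ultrapower of the operator algebra
non-zero. -/
instance : Nontrivial (ℕ →ᵇ ℂ) := ⟨0, 1, fun h => zero_ne_one (DFunLike.congr_fun h 0)⟩

/-- The composition operator `f ↦ f ∘ g` on bounded functions on `ℕ`. -/
noncomputable def compL (g : ℕ → ℕ) : (ℕ →ᵇ ℂ) →L[ℂ] (ℕ →ᵇ ℂ) :=
  LinearMap.mkContinuous
    { toFun := fun f => f.compContinuous ⟨g, continuous_of_discreteTopology⟩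
      map_add' := fun _ _ => rfl
      map_smul' := fun _ _ => rfl } 1
    fun f => by
      rw [one_mul]
      exact (BoundedContinuousFunction.norm_le (norm_nonneg f)).2 fun k => f.norm_coe_le_norm (g k)

@[simp] theorem compL_apply (g : ℕ → ℕ) (f : ℕ →ᵇ ℂ) (k : ℕ) : compL g f k = f (g k) := rfl

theorem norm_compL_le (g : ℕ → ℕ) : ‖compL g‖ ≤ 1 := LinearMap.mkContinuous_norm_le _ zero_le_one _

/-- The isometry `f ↦ (k ↦ f ⌊k / 2⌋ if k ≡ i mod 2, else 0)` on bounded functions on `ℕ`. -/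
noncomputable def interleave (i : Fin 2) : (ℕ →ᵇ ℂ) →L[ℂ] (ℕ →ᵇ ℂ) :=
  have key : ∀ (f : ℕ →ᵇ ℂ) (k : ℕ), ‖if k % 2 = i then f (k / 2) else 0‖ ≤ ‖f‖ := fun f k => by
    split_ifs
    · exact f.norm_coe_le_norm _
    · simp
  LinearMap.mkContinuous
    { toFun := fun f => BoundedContinuousFunction.ofNormedAddCommGroupDiscrete
        (fun k => if k % 2 = i then f (k / 2) else 0) ‖f‖ (key f)
      map_add' := fun f g => by
        ext k
        by_cases h : k % 2 = i <;> simp [h]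
      map_smul' := fun c f => by
        ext k
        by_cases h : k % 2 = i <;> simp [h] } 1
    fun f => by
      rw [one_mul]
      exact (BoundedContinuousFunction.norm_le (norm_nonneg f)).2 (key f)

@[simp] theorem interleave_apply (i : Fin 2) (f : ℕ →ᵇ ℂ) (k : ℕ) :
    interleave i f k = if k % 2 = i then f (k / 2) else 0 := rfl

theorem norm_interleave_le (i : Fin 2) : ‖interleave i‖ ≤ 1 := by
  refine ContinuousLinearMap.opNorm_le_bound _ zero_le_one fun f => ?_
  rw [one_mul]
  refine (BoundedContinuousFunction.norm_le (norm_nonneg f)).2 fun k => ?_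
  rw [interleave_apply]
  split_ifs
  · exact f.norm_coe_le_norm _
  · simp

theorem compL_mul_interleave (i j : Fin 2) :
    compL (fun k => 2 * k + i) * interleave j = if i = j then 1 else 0 := by
  ext f k
  have hmod : (2 * k + i) % 2 = (i : ℕ) := by omega
  have hdiv : (2 * k + i) / 2 = k := by omega
  by_cases h : i = j
  · subst h
    simp [hmod, hdiv]
  · simp [hmod, h, Fin.val_inj]

/-- The two summands restrict a function to the even and to the odd integers. -/
theorem sum_interleave_mul_compL :
    interleave 0 * compL (fun k => 2 * k + (0 : Fin 2)) +
      interleave 1 * compL (fun k => 2 * k + (1 : Fin 2)) = 1 := by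
  ext f k
  rcases Nat.mod_two_eq_zero_or_one k with h | h
  · have hk : 2 * (k / 2) = k := by omega
    simp [h, hk]
  · have hk : 2 * (k / 2) + 1 = k := by omega
    simp [h, hk]

/-- Exactly one of the two terms is non-zero at each `k` where `f (k / 2)` is. Hence the sum is
again a composition operator, of norm at most 1 instead of the 2 of the triangle inequality. -/
theorem interleave_zero_add_interleave_one :
    interleave 0 + interleave 1 = compL (fun k => k / 2) := by
  ext f k
  rcases Nat.mod_two_eq_zero_or_one k with h | h <;> simp [h]

/-- The Cuntz family of interleaving operators on the bounded functions on `ℕ`. -/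
noncomputable def interleaveFamily : ContractiveCuntzFamily ((ℕ →ᵇ ℂ) →L[ℂ] (ℕ →ᵇ ℂ)) where
  s := interleave
  t i := compL fun k => 2 * k + i
  norm_s_le := norm_interleave_le
  norm_t_le _ := norm_compL_le _
  t_mul_s := compL_mul_interleave
  sum_s_mul_t := sum_interleave_mul_compL

theorem norm_interleave_add_le : ‖interleave 0 + interleave 1‖ ≤ 1 := by
  rw [interleave_zero_add_interleave_one]
  exact norm_compL_le _

theorem half_smul_compL_add_compL_one (g h : ℕ → ℕ) :
    ((1 / 2 : ℂ) • (compL g + compL h)) 1 = 1 := by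
  ext k
  simp
  norm_num

/-- Composition fixes constants, so every power of the mean fixes the function 1, which has norm 1.
-/
theorem one_le_norm_half_smul_compL_add_compL_pow (g h : ℕ → ℕ) (n : ℕ) :
    1 ≤ ‖((1 / 2 : ℂ) • (compL g + compL h)) ^ n‖ := by
  have h1 : (((1 / 2 : ℂ) • (compL g + compL h)) ^ n) 1 = 1 := by
    induction n with
    | zero => rfl
    | succ n ih => rw [pow_succ, mul_apply_eq_comp, half_smul_compL_add_compL_one, ih]
  have h2 := (((1 / 2 : ℂ) • (compL g + compL h)) ^ n).le_opNorm 1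
  rwa [h1, norm_one, mul_one] at h2

end CuntzUltra

theorem theorem3p20 {ι : Type*} (U : Ultrafilter ι) (hU : CuntzUltra.IsCountablyIncomplete U) :
    Nontrivial (CuntzUltra.Ultrapower U CuntzUltra.CuntzQuot) ∧
    ¬ IsSimpleRing (CuntzUltra.Ultrapower U CuntzUltra.CuntzQuot) ∧
    ¬ CuntzUltra.IsPurelyInfinite (CuntzUltra.Ultrapower U CuntzUltra.CuntzQuot) := by
  obtain ⟨α, hα, h⟩ := CuntzUltra.interleaveFamily.exists_ne_zero_map_quotRep_eq_zero
    CuntzUltra.norm_interleave_add_le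
    (CuntzUltra.one_le_norm_half_smul_compL_add_compL_pow _ _) hU
  exact ⟨⟨α, 0, hα⟩, CuntzUltra.not_isSimpleRing_of_map_eq_zero _ hα h,
    CuntzUltra.not_isPurelyInfinite_of_map_eq_zero _ hα h⟩
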